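/- All rings are commutative with identity. Let $R$ be a Noetherian ring and let $M$ be a finitely generated $R$-module. For an ideal $I$ of $R$, let $H^i_I(N)=\varinjlim_n\operatorname{Ext}^i_R(R/I^n,N)$ denote the $i$-th local cohomology module of an $R$-module $N$. For a finite sequence ${\bf x}=x_1,\ldots,x_\ell$ in $R$ and $n\ge 0$ put ${\bf x}^n=x_1^n,\ldots,x_\ell^n$. Let $\mathbb K_\bullet({\bf x};M)=\mathbb K_\bullet(x_1)\otimes_R\cdots\otimes_R\mathbb K_\bullet(x_\ell)\otimes_R M$ be the Koszul complex, where $\mathbb K_\bullet(x)$ is the complex $0\to R\xrightarrow{\,x\,}R\to 0$ in degrees $1,0$, and let $H_i({\bf x};M)$ be its $i$-th homology. For $m\ge n$ let $\phi^m_n:\mathbb K_\bullet({\bf x}^m;M)\to\mathbb K_\bullet({\bf x}^n;M)$ be the tensor product of the identity of $M$ with the chain maps $\mathbb K_\bullet(x_j^m)\to\mathbb K_\bullet(x_j^n)$ ($1\le j\le\ell$) that are the identity in degree $0$ and multiplication by $x_j^{m-n}$ in degree $1$. The sequence ${\bf x}$ is called $M$-weakly proregular if for each $n$ there is an $m\ge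 n$ such that the map $H_i({\bf x}^m;M)\to H_i({\bf x}^n;M)$ induced by $\phi^m_n$ is zero for all $i\ge1$. Then: 1. $H^i_I(\operatorname{Hom}_R(M,E))=0$ for every ideal $I$ of $R$, every injective $R$-module $E$ and every $i\ne0$; 2. every finite sequence of elements of $R$ is $M$-weakly proregular. -/

import Mathlib

open CategoryTheory

universe v u

noncomputable section

namespace Koszul

variable {R : Type u} [CommRing R]

/-- The degree `n` part of `K(x) ⊗ L`, where `K(x)` is the complex `0 → R → R → 0` in degrees
`1, 0`: this is `(R e₀ ⊗ Lₙ) ⊕ (R e₁ ⊗ Lₙ₋₁) = Lₙ ⊕ Lₙ₋₁`, and `(a, b)` stands for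
`e₀ ⊗ a + e₁ ⊗ b`. -/
def tensorX (L : ChainComplex (ModuleCat.{v} R) ℕ) : ℕ → ModuleCat.{v} R
  | 0 => L.X 0
  | n + 1 => ModuleCat.of R (L.X (n + 1) × L.X n)

/-- The differential of `K(x) ⊗ L`. As the differential of `K(x)` sends `e₁` to `x e₀`, it is
`d (e₀ ⊗ a + e₁ ⊗ b) = e₀ ⊗ (d a + x b) - e₁ ⊗ d b`. -/
def tensorD (x : R) (L : ChainComplex (ModuleCat.{v} R) ℕ) :
    ∀ n : ℕ, tensorX L (n + 1) ⟶ tensorX L n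
  | 0 => ModuleCat.ofHom (LinearMap.coprod (L.d 1 0).hom (x • LinearMap.id))
  | n + 1 => ModuleCat.ofHom
      (LinearMap.prod
        (LinearMap.coprod (L.d (n + 2) (n + 1)).hom (x • LinearMap.id))
        (-((L.d (n + 1) n).hom ∘ₗ LinearMap.snd R (L.X (n + 2)) (L.X (n + 1)))))

lemma d_d_apply (L : ChainComplex (ModuleCat.{v} R) ℕ) (i j k : ℕ) (a : L.X i) :
    (L.d j k).hom ((L.d i j).hom a) = 0 := by
  rw [← LinearMap.comp_apply, ← ModuleCat.hom_comp, L.d_comp_d]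
  rfl

lemma tensorD_comp_tensorD (x : R) (L : ChainComplex (ModuleCat.{v} R) ℕ) (n : ℕ) :
    tensorD x L (n + 1) ≫ tensorD x L n = 0 := by
  cases n with
  | zero =>
    ext ⟨a, b⟩
    change (L.d 1 0).hom ((L.d 2 1).hom a + x • b) + x • (-((L.d 1 0).hom b)) = 0
    simp [d_d_apply]
  | succ n =>
    ext ⟨a, b⟩
    change ((L.d (n + 2) (n + 1)).hom ((L.d (n + 3) (n + 2)).hom a + x • b)
        + x • (-((L.d (n + 2) (n + 1)).hom b)),
      -((L.d (n + 1) n).hom (-((L.d (n + 2) (n + 1)).hom b)))) = 0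
    simp [d_d_apply]

/-- The tensor product `K(x) ⊗ L` of the complex `K(x) : 0 → R → R → 0` (multiplication by `x`,
in degrees `1, 0`) with a chain complex `L`. -/
def tensor (x : R) (L : ChainComplex (ModuleCat.{v} R) ℕ) : ChainComplex (ModuleCat.{v} R) ℕ :=
  ChainComplex.of (tensorX L) (tensorD x L) (tensorD_comp_tensorD x L)

lemma tensor_d (x : R) (L : ChainComplex (ModuleCat.{v} R) ℕ) (n : ℕ) :
    (tensor x L).d (n + 1) n = tensorD x L n :=
  ChainComplex.of_d _ _ _

/-- The degree `n` part of `φ ⊗ f`, where `φ : K(x) → K(x')` is the identity in degree `0` and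
multiplication by `y` in degree `1`: it sends `e₀ ⊗ a + e₁ ⊗ b` to `e₀ ⊗ f a + e₁ ⊗ y f b`. -/
def tensorMapX (y : R) {L L' : ChainComplex (ModuleCat.{v} R) ℕ} (f : L ⟶ L') :
    ∀ n : ℕ, tensorX L n ⟶ tensorX L' n
  | 0 => f.f 0
  | n + 1 => ModuleCat.ofHom (LinearMap.prodMap (f.f (n + 1)).hom (y • (f.f n).hom))

lemma comm_apply {L L' : ChainComplex (ModuleCat.{v} R) ℕ} (f : L ⟶ L') (i j : ℕ) (a : L.X i) :
    (L'.d i j).hom ((f.f i).hom a) = (f.f j).hom ((L.d i j).hom a) := by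
  rw [← LinearMap.comp_apply, ← LinearMap.comp_apply, ← ModuleCat.hom_comp, ← ModuleCat.hom_comp,
    f.comm]

lemma tensorMapX_comm {x x' y : R} (h : x = x' * y) {L L' : ChainComplex (ModuleCat.{v} R) ℕ}
    (f : L ⟶ L') (n : ℕ) :
    tensorMapX y f (n + 1) ≫ tensorD x' L' n = tensorD x L n ≫ tensorMapX y f n := by
  subst h
  cases n with
  | zero =>
    ext ⟨a, b⟩
    change (L'.d 1 0).hom ((f.f 1).hom a) + x' • (y • (f.f 0).hom b) =
      (f.f 0).hom ((L.d 1 0).hom a + (x' * y) • b)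
    simp [comm_apply, mul_smul]
  | succ n =>
    ext ⟨a, b⟩
    change ((L'.d (n + 2) (n + 1)).hom ((f.f (n + 2)).hom a) + x' • (y • (f.f (n + 1)).hom b),
        -((L'.d (n + 1) n).hom (y • (f.f (n + 1)).hom b))) =
      ((f.f (n + 1)).hom ((L.d (n + 2) (n + 1)).hom a + (x' * y) • b),
        y • (f.f n).hom (-((L.d (n + 1) n).hom b)))
    simp [comm_apply, mul_smul]

/-- The chain map `φ ⊗ f : K(x) ⊗ L → K(x') ⊗ L'`, where `x = x' y` and `φ : K(x) → K(x')` is the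
identity in degree `0` and multiplication by `y` in degree `1`. -/
def tensorMap {x x' y : R} (h : x = x' * y) {L L' : ChainComplex (ModuleCat.{v} R) ℕ}
    (f : L ⟶ L') : tensor x L ⟶ tensor x' L' :=
  ChainComplex.ofHom (tensorMapX y f) fun n => by
    rw [tensor_d x' L' n, tensor_d x L n]
    exact tensorMapX_comm h f n

/-- The Koszul complex `K(x₁, …, x_ℓ; M) = K(x₁) ⊗ ⋯ ⊗ K(x_ℓ) ⊗ M`, with `M` in degree `0`. -/
def complex (M : ModuleCat.{v} R) : List R → ChainComplex (ModuleCat.{v} R) ℕ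
  | [] => (ChainComplex.single₀ (ModuleCat.{v} R)).obj M
  | x :: xs => tensor x (complex M xs)

/-- The chain map `φₙᵐ : K(x₁ᵐ, …, x_ℓᵐ; M) → K(x₁ⁿ, …, x_ℓⁿ; M)` for `n ≤ m`, the tensor product
of the maps `K(x_jᵐ) → K(x_jⁿ)` that are the identity in degree `0` and multiplication by
`x_jᵐ⁻ⁿ` in degree `1`. -/
def transition (M : ModuleCat.{v} R) {n m : ℕ} (h : n ≤ m) :
    ∀ xs : List R, complex M (xs.map (· ^ m)) ⟶ complex M (xs.map (· ^ n))
  | [] => 𝟙 _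
  | x :: xs => tensorMap (pow_mul_pow_sub x h).symm (transition M h xs)

end Koszul

/-- A finite sequence `xs` of elements of `R` is `M`-weakly proregular if for each `n` there is
`m ≥ n` such that `φₙᵐ` induces the zero map on Koszul homology `Hᵢ(xsᵐ; M) → Hᵢ(xsⁿ; M)` for all
`i ≥ 1`. -/
def IsWeaklyProregular {R : Type u} [CommRing R] (xs : List R)
    (M : Type v) [AddCommGroup M] [Module R M] : Prop :=
  ∀ n : ℕ, ∃ m : ℕ, ∃ h : n ≤ m, ∀ i : ℕ, 1 ≤ i →
    HomologicalComplex.homologyMap (Koszul.transition (ModuleCat.of R M) h xs) i = 0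

end

/-! Both halves come from Noetherian stabilization at a finite stage, before any limit is taken.
Weak proregularity is an induction on the sequence: `mapsCyclesToBoundaries_tensorMap_comp` composes
two good transitions of the shorter sequence to get one for the longer. The only new obstruction is
in degree `0`, where the chain of colon submodules by powers of `x` stabilizes. For local
cohomology, take `F → M` onto, with `F` finite free and kernel `K`. In `0 → Hom(M, E) → Hom(F, E) →
Hom(K, E) → 0` the middle term is injective, so dimension shifting (`ExtMapVanishes.succ`) descends
to degree `1`. There Artin–Rees extends maps `K → E` killed by `I ^ n` to maps `F → E` killed by `I
^ m`. So the maps `Extⁱ(R/Iⁿ, -) → Extⁱ(R/Iᵐ, -)` vanish on `Hom(M, E)` for some `m`, and the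
colimit is zero. -/

noncomputable section

/-! ### Koszul homology and weak proregularity -/

namespace Koszul

variable {R : Type u} [CommRing R]

/-- The image of every cycle of degree `i` is a boundary. -/
def MapsCyclesToBoundaries {L L' : ChainComplex (ModuleCat.{v} R) ℕ} (f : L ⟶ L') (i : ℕ) : Prop :=
  ∀ z : L.X (i + 1), (L.d (i + 1) i).hom z = 0 →
    ∃ w : L'.X (i + 2), (L'.d (i + 2) (i + 1)).hom w = (f.f (i + 1)).hom z

lemma homologyMap_eq_zero {L L' : ChainComplex (ModuleCat.{v} R) ℕ} {f : L ⟶ L'} {i : ℕ}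
    (h : MapsCyclesToBoundaries f i) : HomologicalComplex.homologyMap f (i + 1) = 0 := by
  rw [← cancel_epi (L.homologyπ (i + 1)), HomologicalComplex.homologyπ_naturality,
    Limits.comp_zero]
  ext z
  obtain ⟨w, hw⟩ := h ((L.iCycles (i + 1)).hom z) (by
    rw [← LinearMap.comp_apply, ← ModuleCat.hom_comp, L.iCycles_d]; rfl)
  have key : (HomologicalComplex.cyclesMap f (i + 1)).hom z =
      (L'.toCycles (i + 2) (i + 1)).hom w := by
    apply (ModuleCat.mono_iff_injective (L'.iCycles (i + 1))).1 inferInstance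
    change ((HomologicalComplex.cyclesMap f (i + 1)) ≫ L'.iCycles (i + 1)).hom z =
      (L'.toCycles (i + 2) (i + 1) ≫ L'.iCycles (i + 1)).hom w
    rw [HomologicalComplex.cyclesMap_i, HomologicalComplex.toCycles_i]
    exact hw.symm
  change (L'.homologyπ (i + 1)).hom ((HomologicalComplex.cyclesMap f (i + 1)).hom z) = 0
  rw [key]
  change (L'.toCycles (i + 2) (i + 1) ≫ L'.homologyπ (i + 1)).hom w = 0
  rw [HomologicalComplex.toCycles_comp_homologyπ]
  rfl

lemma tensorD_apply (x : R) (L : ChainComplex (ModuleCat.{v} R) ℕ) (n : ℕ)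
    (a : L.X (n + 2)) (b : L.X (n + 1)) :
    ((tensor x L).d (n + 2) (n + 1)).hom (a, b) =
      ((L.d (n + 2) (n + 1)).hom a + x • b, -(L.d (n + 1) n).hom b) := by
  rw [tensor_d]; rfl

lemma tensorD_apply_zero (x : R) (L : ChainComplex (ModuleCat.{v} R) ℕ)
    (a : L.X 1) (b : L.X 0) :
    ((tensor x L).d 1 0).hom (a, b) = (L.d 1 0).hom a + x • b := by
  rw [tensor_d]; rfl

lemma tensorMap_apply {x x' y : R} (h : x = x' * y) {L L' : ChainComplex (ModuleCat.{v} R) ℕ}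
    (f : L ⟶ L') (n : ℕ) (a : L.X (n + 1)) (b : L.X n) :
    ((tensorMap h f).f (n + 1)).hom (a, b) = ((f.f (n + 1)).hom a, y • (f.f n).hom b) := rfl

/-- For a cycle `(a, b)`, `f` turns `y b` into a boundary `d c`; correcting `f a` by `x₂ c` gives a
cycle, which `g` turns into a boundary. In degree `0` being a cycle says nothing about `b`, hence
the separate hypothesis `hf₀`. -/
lemma mapsCyclesToBoundaries_tensorMap_comp {x₁ x₂ x₃ y z : R} (h₁ : x₁ = x₂ * y) (h₂ : x₂ = x₃ * z)
    {L₁ L₂ L₃ : ChainComplex (ModuleCat.{v} R) ℕ} (f : L₁ ⟶ L₂) (g : L₂ ⟶ L₃)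
    (hf : ∀ i, MapsCyclesToBoundaries f i) (hg : ∀ i, MapsCyclesToBoundaries g i)
    (hf₀ : ∀ (a : L₁.X 1) (b : L₁.X 0), (L₁.d 1 0).hom a + x₁ • b = 0 →
      ∃ c, (L₂.d 1 0).hom c = y • (f.f 0).hom b) (i : ℕ) :
    MapsCyclesToBoundaries (tensorMap h₁ f ≫ tensorMap h₂ g) i := by
  rintro ⟨a, b⟩ hz
  have hab : (L₁.d (i + 1) i).hom a + x₁ • b = 0 := by
    cases i with
    | zero => rwa [tensorD_apply_zero] at hz
    | succ i => rw [tensorD_apply] at hz; exact congrArg Prod.fst hz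
  obtain ⟨c, hc⟩ : ∃ c, (L₂.d (i + 1) i).hom c = y • (f.f i).hom b := by
    cases i with
    | zero => exact hf₀ a b hab
    | succ i =>
      rw [tensorD_apply] at hz
      obtain ⟨c, hc⟩ := hf i b (neg_eq_zero.1 (congrArg Prod.snd hz))
      exact ⟨y • c, by rw [map_smul, hc]⟩
  obtain ⟨e, he⟩ := hg i ((f.f (i + 1)).hom a + x₂ • c) (by
    rw [map_add, map_smul, hc, comm_apply, smul_smul, ← h₁, ← map_smul, ← map_add, hab, map_zero])
  -- Since `x₂ = x₃ z`, the second entry cancels the correction `x₂ c` contained in `d e`.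
  refine ⟨(e, -(z • (g.f (i + 1)).hom c)), ?_⟩
  rw [tensorD_apply]
  change _ = ((g.f (i + 1)).hom ((f.f (i + 1)).hom a), z • (g.f i).hom (y • (f.f i).hom b))
  rw [he, ← hc, ← comm_apply, map_neg, map_smul, neg_neg, map_add, map_smul, h₂, mul_smul, smul_neg,
    add_neg_cancel_right]

lemma tensorMap_comp {x₁ x₂ x₃ y z w : R} (h₁ : x₁ = x₂ * y) (h₂ : x₂ = x₃ * z) (h : x₁ = x₃ * w)
    (hw : w = z * y) {L₁ L₂ L₃ : ChainComplex (ModuleCat.{v} R) ℕ} (f : L₁ ⟶ L₂) (g : L₂ ⟶ L₃) :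
    tensorMap h₁ f ≫ tensorMap h₂ g = tensorMap h (f ≫ g) := by
  subst hw
  ext n : 1
  cases n with
  | zero => rfl
  | succ n =>
    ext ⟨a, b⟩
    change ((g.f (n + 1)).hom ((f.f (n + 1)).hom a), z • (g.f n).hom (y • (f.f n).hom b)) =
      ((g.f (n + 1)).hom ((f.f (n + 1)).hom a), (z * y) • (g.f n).hom ((f.f n).hom b))
    rw [map_smul, smul_smul]

lemma transition_comp (M : ModuleCat.{v} R) {k n m : ℕ} (h : k ≤ n) (h' : n ≤ m) (xs : List R) :
    transition M h' xs ≫ transition M h xs = transition M (h.trans h') xs := by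
  induction xs with
  | nil => exact Category.comp_id _
  | cons x xs ih =>
    rw [transition, transition, transition, ← ih]
    apply tensorMap_comp
    rw [← pow_add]
    congr 1
    omega

lemma isNoetherian_complex_X_zero (M : ModuleCat.{v} R) [IsNoetherian R M] (xs : List R) :
    IsNoetherian R ((complex M xs).X 0) := by
  induction xs with
  | nil => exact ‹IsNoetherian R M›
  | cons x xs ih => exact ih

lemma mapsCyclesToBoundaries_comp_left {L L' L'' : ChainComplex (ModuleCat.{v} R) ℕ} (f : L ⟶ L')
    (g : L' ⟶ L'') {i : ℕ} (h : MapsCyclesToBoundaries g i) :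
    MapsCyclesToBoundaries (f ≫ g) i := fun z hz =>
  h ((f.f (i + 1)).hom z) (by rw [comm_apply, hz, map_zero])

end Koszul

/-- The submodules `(B : x ^ k)` increase with `k`, so they stabilize. -/
lemma exists_pow_smul_mem_of_isNoetherian {R : Type u} [CommRing R] {Q : Type v} [AddCommGroup Q]
    [Module R Q] [IsNoetherian R Q] (B : Submodule R Q) (x : R) :
    ∃ c : ℕ, ∀ k (b : Q), x ^ k • b ∈ B → x ^ c • b ∈ B := by
  let F : ℕ →o Submodule R Q :=
    ⟨fun k => B.comap (x ^ k • LinearMap.id), monotone_nat_of_le_succ fun k b hb => by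
      change x ^ (k + 1) • b ∈ B
      rw [pow_succ', mul_smul]
      exact B.smul_mem _ hb⟩
  obtain ⟨c, hc⟩ := monotone_stabilizes_iff_noetherian.2 ‹IsNoetherian R Q› F
  refine ⟨c, fun k b hb => ?_⟩
  change b ∈ F c
  obtain h | h := le_total k c
  · exact F.monotone h hb
  · rw [hc k h]; exact hb

namespace Koszul

variable {R : Type u} [CommRing R]

lemma exists_mapsCyclesToBoundaries_transition (M : ModuleCat.{v} R) [IsNoetherian R M]
    (xs : List R) (n : ℕ) :
    ∃ m, ∃ h : n ≤ m, ∀ i, MapsCyclesToBoundaries (transition M h xs) i := by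
  induction xs generalizing n with
  | nil =>
    refine ⟨n, le_rfl, fun i z _ => ⟨0, ?_⟩⟩
    have := ModuleCat.subsingleton_of_isZero
      (HomologicalComplex.isZero_single_obj_X (ComplexShape.down ℕ) 0 M (i + 1) (by simp))
    exact @Subsingleton.elim _ this _ _
  | cons x xs ih =>
    obtain ⟨m₁, h₁, H₁⟩ := ih n
    obtain ⟨m₂, h₂, H₂⟩ := ih m₁
    have := isNoetherian_complex_X_zero M (xs.map (· ^ m₁))
    obtain ⟨c, hc⟩ := exists_pow_smul_mem_of_isNoetherian
      (LinearMap.range ((complex M (xs.map (· ^ m₁))).d 1 0).hom) x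
    have h₃ : m₁ ≤ max m₂ (m₁ + c) := h₂.trans (le_max_left _ _)
    -- At least `m₂`, so that cycles of the shorter complex die at stage `m₁`; at least `m₁ + c`, so
    -- that the factor on `e₁` is divisible by `x ^ c`.
    refine ⟨max m₂ (m₁ + c), h₁.trans h₃, fun i => ?_⟩
    rw [← transition_comp M h₁ h₃]
    refine mapsCyclesToBoundaries_tensorMap_comp _ _ _ _ (fun i => ?_) H₁ (fun a b hab => ?_) i
    · rw [← transition_comp M h₂ (le_max_left _ _)]
      exact mapsCyclesToBoundaries_comp_left _ _ (H₂ i)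
    · have hb := hc (max m₂ (m₁ + c)) (((transition M h₃ xs).f 0).hom b)
        ⟨-((transition M h₃ xs).f 1).hom a, by
          rw [map_neg, comm_apply, ← map_smul, ← map_neg, neg_eq_of_add_eq_zero_right hab]⟩
      have := Submodule.smul_mem _ (x ^ (max m₂ (m₁ + c) - m₁ - c)) hb
      rwa [smul_smul, ← pow_add, Nat.sub_add_cancel (by omega)] at this

end Koszul

theorem isWeaklyProregular_of_isNoetherian {R : Type u} [CommRing R] (xs : List R)
    (M : Type v) [AddCommGroup M] [Module R M] [IsNoetherian R M] : IsWeaklyProregular xs M := by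
  intro n
  have : IsNoetherian R (ModuleCat.of R M) := ‹IsNoetherian R M›
  obtain ⟨m, h, H⟩ := Koszul.exists_mapsCyclesToBoundaries_transition (ModuleCat.of R M) xs n
  refine ⟨m, h, fun i hi => ?_⟩
  obtain ⟨i, rfl⟩ := Nat.exists_eq_succ_of_ne_zero (Nat.one_le_iff_ne_zero.1 hi)
  exact Koszul.homologyMap_eq_zero (H i)

/-! ### Vanishing of maps on Ext and dimension shifting -/

lemma ModuleCat.shortComplex_homologyMap_eq_zero {R : Type u} [Ring R]
    {S S' : ShortComplex (ModuleCat.{v} R)} (φ : S ⟶ S')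
    (h : ∀ z : S.X₂, S.g.hom z = 0 → ∃ w : S'.X₁, S'.f.hom w = φ.τ₂.hom z) :
    ShortComplex.homologyMap φ = 0 := by
  rw [← cancel_epi S.homologyπ, ShortComplex.homologyπ_naturality, Limits.comp_zero]
  ext z
  obtain ⟨w, hw⟩ := h (S.iCycles.hom z) (by
    rw [← LinearMap.comp_apply, ← ModuleCat.hom_comp, S.iCycles_g]; rfl)
  have key : (ShortComplex.cyclesMap φ).hom z = S'.toCycles.hom w := by
    apply (ModuleCat.mono_iff_injective S'.iCycles).1 inferInstance
    change (ShortComplex.cyclesMap φ ≫ S'.iCycles).hom z = (S'.toCycles ≫ S'.iCycles).hom w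
    rw [ShortComplex.cyclesMap_i, ShortComplex.toCycles_i]
    exact hw.symm
  change S'.homologyπ.hom ((ShortComplex.cyclesMap φ).hom z) = 0
  rw [key]
  change (S'.toCycles ≫ S'.homologyπ).hom w = 0
  rw [ShortComplex.toCycles_comp_homologyπ]
  rfl

namespace CategoryTheory

variable {C : Type u} [Category.{v} C] [Abelian C]

/-- For chain maps lifting `u : X ⟶ Y` to projective resolutions, this expresses that
`Extⁱ(Y, N) → Extⁱ(X, N)` vanishes for `i = n + 1`. -/
def ExtMapVanishes {K L : ChainComplex C ℕ} (φ : K ⟶ L) (N : C) (n : ℕ) : Prop :=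
  ∀ f : L.X (n + 1) ⟶ N, L.d (n + 2) (n + 1) ≫ f = 0 →
    ∃ g : K.X n ⟶ N, K.d (n + 1) n ≫ g = φ.f (n + 1) ≫ f

variable {S : ShortComplex C} (hS : S.ShortExact) [Injective S.X₂] {X Y : C}
  {P : ProjectiveResolution X} {Q : ProjectiveResolution Y}

include hS in
-- A cocycle `f` becomes the coboundary of some `k` in the injective `S.X₂`, and `k ≫ S.g` is a
-- cocycle one degree lower. Its pullback bounds some `g`; subtracting from the pullback of `k` the
-- coboundary of a lift of `g` leaves a map into `S.X₁`.
lemma ExtMapVanishes.succ {φ : P.complex ⟶ Q.complex} {n : ℕ} (h : ExtMapVanishes φ S.X₃ n) :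
    ExtMapVanishes φ S.X₁ (n + 1) := by
  intro f hf
  have := hS.mono_f
  have := hS.epi_g
  let k : Q.complex.X (n + 1) ⟶ S.X₂ := (Q.exact_succ (n + 1)).descToInjective (f ≫ S.f) (by
    change Q.complex.d _ _ ≫ f ≫ S.f = 0
    rw [← Category.assoc, hf, Limits.zero_comp])
  have hk : Q.complex.d (n + 2) (n + 1) ≫ k = f ≫ S.f :=
    (Q.exact_succ (n + 1)).comp_descToInjective _ _
  obtain ⟨g, hg⟩ := h (k ≫ S.g) (by
    rw [← Category.assoc, hk, Category.assoc, S.zero, Limits.comp_zero])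
  let g' := Projective.factorThru g S.g
  have hg' : g' ≫ S.g = g := Projective.factorThru_comp _ _
  let l := hS.exact.lift (φ.f (n + 1) ≫ k - P.complex.d (n + 1) n ≫ g') (by
    simp [hg', hg])
  have hl : l ≫ S.f = _ := hS.exact.lift_f _ _
  refine ⟨l, ?_⟩
  rw [← cancel_mono S.f, Category.assoc, hl, Preadditive.comp_sub, ← Category.assoc, ← φ.comm,
    Category.assoc, hk, ← Category.assoc (P.complex.d _ _), P.complex.d_comp_d, Limits.zero_comp, sub_zero,
    Category.assoc]

include hS in
-- Injectivity of `S.X₂` makes every class in `Ext¹(Y, S.X₁)` come from some `w : Y ⟶ S.X₃`; it dies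
-- on `X` once `u ≫ w` lifts to `S.X₂`.
lemma extMapVanishes_zero {u : X ⟶ Y} {φ : P.complex ⟶ Q.complex}
    (p : P.complex.X 0 ⟶ X) (q : Q.complex.X 0 ⟶ Y) (hq₀ : Epi q)
    (hp : P.complex.d (0 + 1) 0 ≫ p = 0) {hq : Q.complex.d 1 0 ≫ q = 0}
    (hq' : (ShortComplex.mk _ _ hq).Exact) (hφ : φ.f 0 ≫ q = p ≫ u)
    (h : ∀ w : Y ⟶ S.X₃, ∃ w' : X ⟶ S.X₂, w' ≫ S.g = u ≫ w) :
    ExtMapVanishes φ S.X₁ 0 := by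
  intro f hf
  have := hS.mono_f
  let k : Q.complex.X 0 ⟶ S.X₂ := (Q.exact_succ 0).descToInjective (f ≫ S.f) (by
    change Q.complex.d _ _ ≫ f ≫ S.f = 0
    rw [← Category.assoc, hf, Limits.zero_comp])
  have hk : Q.complex.d 1 0 ≫ k = f ≫ S.f := (Q.exact_succ 0).comp_descToInjective _ _
  have hk' : Q.complex.d 1 0 ≫ k ≫ S.g = 0 := by
    rw [← Category.assoc, hk, Category.assoc, S.zero, Limits.comp_zero]
  have : Epi (ShortComplex.mk _ _ hq).g := hq₀
  obtain ⟨w, hw⟩ : ∃ w : Y ⟶ S.X₃, q ≫ w = k ≫ S.g :=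
    ⟨hq'.desc (k ≫ S.g) hk', hq'.g_desc _ _⟩
  obtain ⟨w', hw'⟩ := h w
  let l := hS.exact.lift (φ.f 0 ≫ k - p ≫ w') (by
    rw [Preadditive.sub_comp, Category.assoc, ← hw, ← Category.assoc, hφ, sub_eq_zero,
      Category.assoc, Category.assoc, hw'])
  have hl : l ≫ S.f = _ := hS.exact.lift_f _ _
  refine ⟨l, ?_⟩
  rw [← cancel_mono S.f, Category.assoc, hl, Preadditive.comp_sub, ← Category.assoc, ← φ.comm,
    Category.assoc, hk, ← Category.assoc (P.complex.d _ _), hp, Limits.zero_comp, sub_zero,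
    Category.assoc]

variable {R : Type*} [Ring R] [Linear R C] [EnoughProjectives C]

lemma Ext_map_app_eq_zero {u : X ⟶ Y} {φ : P.complex ⟶ Q.complex}
    (hφ : φ ≫ Q.π = P.π ≫ (ChainComplex.single₀ C).map u) {N : C} {n : ℕ}
    (h : ExtMapVanishes φ N n) : ((Ext R C (n + 1)).map u.op).app N = 0 := by
  let F : C ⥤ (ModuleCat R)ᵒᵖ := ((linearYoneda R C).obj N).rightOp
  change ((F.leftDerived (n + 1)).map u).unop = 0
  rw [Functor.leftDerived_map_eq F (n + 1) u φ hφ]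
  let ψ := (F.mapHomologicalComplex (ComplexShape.down ℕ)).map φ
  have key : HomologicalComplex.homologyMap ψ (n + 1) = 0 := by
    let σ := (HomologicalComplex.shortComplexFunctor _ (ComplexShape.down ℕ) (n + 1)).map ψ
    have h₀ : ShortComplex.homologyMap (ShortComplex.unopMap σ) = 0 := by
      apply ModuleCat.shortComplex_homologyMap_eq_zero
      intro f hf
      change Q.complex.X (n + 1) ⟶ N at f
      change Q.complex.d ((ComplexShape.down ℕ).prev (n + 1)) (n + 1) ≫ f = 0 at hf
      change ∃ g : P.complex.X ((ComplexShape.down ℕ).next (n + 1)) ⟶ N,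
        P.complex.d (n + 1) ((ComplexShape.down ℕ).next (n + 1)) ≫ g = φ.f (n + 1) ≫ f
      rw [ChainComplex.next_nat_succ]
      rw [ChainComplex.prev] at hf
      exact h f hf
    -- `Ext` is a left derived functor into the opposite category, so the vanishing proved for
    -- modules is carried across `op`.
    have h₁ := ShortComplex.homologyMap_op (ShortComplex.unopMap σ)
    have h₂ : ShortComplex.homologyMap (ShortComplex.opMap (ShortComplex.unopMap σ)) = 0 := by
      rw [← cancel_epi (ShortComplex.homologyOpIso _).inv,
        ← cancel_mono (ShortComplex.homologyOpIso _).hom, Category.assoc, ← h₁, h₀]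
      simp
    exact h₂
  have key' : (F.mapHomologicalComplex (ComplexShape.down ℕ) ⋙
      HomologicalComplex.homologyFunctor _ _ (n + 1)).map φ = 0 := key
  rw [key', Limits.zero_comp, Limits.comp_zero]
  rfl

end CategoryTheory

/-! ### Artin–Rees and local cohomology of `Hom(M, E)` -/

variable {R : Type u} [CommRing R]

lemma Module.Injective.linearMap_fin (r : ℕ) (E : Type u) [AddCommGroup E] [Module R E]
    [Module.Injective R E] : Module.Injective R ((Fin r → R) →ₗ[R] E) :=
  (Module.Baer.of_equiv ((Pi.basisFun R (Fin r)).constr R)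
    (Module.Baer.of_injective (inferInstance : Module.Injective R (Fin r → E)))).injective

/-- The sequence `0 → Hom(M, E) → Hom(F, E) → Hom(ker p, E) → 0` attached to `p : F → M`. -/
def homShortComplex {F M : Type u} [AddCommGroup F] [Module R F] [AddCommGroup M] [Module R M]
    (p : F →ₗ[R] M) (E : Type u) [AddCommGroup E] [Module R E] : ShortComplex (ModuleCat.{u} R) where
  X₁ := ModuleCat.of R (M →ₗ[R] E)
  X₂ := ModuleCat.of R (F →ₗ[R] E)
  X₃ := ModuleCat.of R (LinearMap.ker p →ₗ[R] E)
  f := ModuleCat.ofHom (LinearMap.lcomp R E p)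
  g := ModuleCat.ofHom (LinearMap.lcomp R E (LinearMap.ker p).subtype)
  zero := by
    ext f : 2
    refine LinearMap.ext fun x => ?_
    change f (p x) = 0
    rw [x.2, map_zero]

lemma homShortComplex_shortExact {F M : Type u} [AddCommGroup F] [Module R F] [AddCommGroup M]
    [Module R M] {p : F →ₗ[R] M} (hp : Function.Surjective p) (E : Type u) [AddCommGroup E]
    [Module R E] [Module.Injective R E] : (homShortComplex p E).ShortExact where
  exact := by
    rw [ShortComplex.moduleCat_exact_iff]
    intro f hf
    change F →ₗ[R] E at f
    have hle : LinearMap.ker p ≤ LinearMap.ker f := fun x hx =>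
      LinearMap.congr_fun hf (⟨x, hx⟩ : LinearMap.ker p)
    refine ⟨(LinearMap.ker p).liftQ f hle ∘ₗ
      (p.quotKerEquivOfSurjective hp).symm.toLinearMap, LinearMap.ext fun x => ?_⟩
    change (LinearMap.ker p).liftQ f hle ((p.quotKerEquivOfSurjective hp).symm (p x)) = f x
    have : (p.quotKerEquivOfSurjective hp).symm (p x) = (LinearMap.ker p).mkQ x := by
      rw [LinearEquiv.symm_apply_eq]; rfl
    rw [this]
    rfl
  mono_f := by
    rw [ModuleCat.mono_iff_injective]
    intro f g hfg
    refine LinearMap.ext fun y => ?_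
    obtain ⟨x, rfl⟩ := hp y
    exact LinearMap.congr_fun hfg x
  epi_g := by
    rw [ModuleCat.epi_iff_surjective]
    intro f
    obtain ⟨g, hg⟩ := Module.Injective.out (LinearMap.ker p).subtype
      (LinearMap.ker p).injective_subtype f
    exact ⟨g, LinearMap.ext hg⟩

/-- A consequence of the Artin–Rees lemma. -/
lemma exists_linearMap_extension_of_pow_smul_eq_zero [IsNoetherianRing R] {F : Type u}
    [AddCommGroup F] [Module R F] [Module.Finite R F] (K : Submodule R F) (I : Ideal R) (n : ℕ) :
    ∃ c, ∀ m, n + c ≤ m → ∀ (E : Type u) [AddCommGroup E] [Module R E] [Module.Injective R E]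
      (ψ : K →ₗ[R] E), (∀ r ∈ I ^ n, r • ψ = 0) →
        ∃ Ψ : F →ₗ[R] E, (∀ r ∈ I ^ m, r • Ψ = 0) ∧ Ψ ∘ₗ K.subtype = ψ := by
  obtain ⟨c, hc⟩ := I.exists_pow_inf_eq_pow_smul K
  refine ⟨c, fun m hm E _ _ _ ψ hψ => ?_⟩
  let T : Submodule R F := I ^ m • ⊤
  -- Artin–Rees gives `I ^ m F ∩ K ⊆ I ^ n K`, and `ψ` kills the right-hand side.
  have hT : T.comap K.subtype ≤ LinearMap.ker ψ := by
    have h₁ : T.comap K.subtype ≤ (I ^ n • ⊤ : Submodule R K) := by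
      rw [← Submodule.map_le_map_iff_of_injective K.injective_subtype, Submodule.map_comap_subtype,
        Submodule.map_smul'', Submodule.map_top, Submodule.range_subtype, inf_comm, hc m (by omega)]
      exact Submodule.smul_mono (Ideal.pow_le_pow_right (by omega)) inf_le_right
    refine h₁.trans (Submodule.smul_le.2 fun r hr x _ => ?_)
    rw [LinearMap.mem_ker, map_smul]
    exact LinearMap.congr_fun (hψ r hr) x
  -- `K / (K ∩ I ^ m F)` embeds in `F / I ^ m F`; extending over the latter makes `I ^ m` act as
  -- zero.
  obtain ⟨g, hg⟩ := Module.Injective.out (Submodule.mapQ (T.comap K.subtype) T K.subtype le_rfl)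
    (by
      rw [← LinearMap.ker_eq_bot, Submodule.mapQ, Submodule.ker_liftQ, LinearMap.ker_comp,
        Submodule.ker_mkQ]
      exact Submodule.mkQ_map_self _)
    ((T.comap K.subtype).liftQ ψ hT)
  refine ⟨g ∘ₗ T.mkQ, fun r hr => LinearMap.ext fun x => ?_, LinearMap.ext fun x => ?_⟩
  · change r • g (T.mkQ x) = 0
    rw [← map_smul, ← map_smul]
    have : T.mkQ (r • x) = 0 :=
      (Submodule.Quotient.mk_eq_zero T).2 (Submodule.smul_mem_smul hr trivial)
    rw [this, map_zero]
  · exact hg ((T.comap K.subtype).mkQ x)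

/-- The projection `R/Iᵐ → R/Iⁿ` for `n ≤ m`. -/
def quotientPowMap (I : Ideal R) {n m : ℕ} (h : n ≤ m) :
    ModuleCat.of R (R ⧸ I ^ m) ⟶ ModuleCat.of R (R ⧸ I ^ n) :=
  ModuleCat.ofHom (Submodule.mapQ _ _ LinearMap.id (Ideal.pow_le_pow_right h))

/-- Induction on `i` replaces `M` by a first syzygy, again finite over the Noetherian ring, and
keeps the same `m`. -/
lemma exists_extMapVanishes_quotientPowMap [IsNoetherianRing R] (I : Ideal R) (i n : ℕ)
    (M : Type u) [AddCommGroup M] [Module R M] [Module.Finite R M] :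
    ∃ m, ∃ h : n ≤ m, ∀ (E : Type u) [AddCommGroup E] [Module R E] [Module.Injective R E]
      (P : ProjectiveResolution (ModuleCat.of R (R ⧸ I ^ m)))
      (Q : ProjectiveResolution (ModuleCat.of R (R ⧸ I ^ n))) (φ : P.complex ⟶ Q.complex),
      φ ≫ Q.π = P.π ≫ (ChainComplex.single₀ _).map (quotientPowMap I h) →
        ExtMapVanishes φ (ModuleCat.of R (M →ₗ[R] E)) i := by
  induction i generalizing M with
  | zero =>
    obtain ⟨r, p, hp⟩ := Module.Finite.exists_fin' R M
    obtain ⟨c, hc⟩ := exists_linearMap_extension_of_pow_smul_eq_zero (LinearMap.ker p) I n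
    refine ⟨n + c, by omega, fun E _ _ _ P Q φ hφ => ?_⟩
    have := Module.Injective.linearMap_fin (R := R) r E
    have : Injective (homShortComplex p E).X₂ := Module.injective_object_of_injective_module R _
    have hq : Epi (Q.π.f 0) := inferInstance
    have hφ₀ := congrArg (fun f => HomologicalComplex.Hom.f f 0) hφ
    refine extMapVanishes_zero (homShortComplex_shortExact hp E) (P.π.f 0) (Q.π.f 0)
      hq P.complex_d_comp_π_f_zero Q.exact₀ hφ₀ fun w => ?_
    change ModuleCat.of R (R ⧸ I ^ n) ⟶ ModuleCat.of R (LinearMap.ker p →ₗ[R] E) at w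
    -- A map out of `R / I ^ n` is the image of `1`, an element killed by `I ^ n`.
    obtain ⟨Ψ, hΨ, hΨ'⟩ := hc (n + c) le_rfl E (w.hom ((I ^ n).mkQ 1)) fun r hr => by
      have : r • (I ^ n).mkQ 1 = 0 := by
        rw [← map_smul, smul_eq_mul, mul_one]
        exact (Submodule.Quotient.mk_eq_zero _).2 hr
      rw [← map_smul, this, map_zero]
    refine ⟨ModuleCat.ofHom ((I ^ (n + c)).liftQ (LinearMap.toSpanSingleton R _ Ψ) hΨ), ?_⟩
    refine ModuleCat.hom_ext (Submodule.linearMap_qext _ (LinearMap.ext_ring ?_))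
    change (((1 : R) • Ψ) ∘ₗ (LinearMap.ker p).subtype) = w.hom ((I ^ n).mkQ 1)
    rw [one_smul, hΨ']
  | succ i ih =>
    obtain ⟨r, p, hp⟩ := Module.Finite.exists_fin' R M
    obtain ⟨m, h, H⟩ := ih (LinearMap.ker p)
    refine ⟨m, h, fun E _ _ _ P Q φ hφ => ?_⟩
    have := Module.Injective.linearMap_fin (R := R) r E
    have : Injective (homShortComplex p E).X₂ := Module.injective_object_of_injective_module R _
    exact (H E P Q φ hφ).succ (homShortComplex_shortExact hp E)

open Opposite in
theorem isZero_localCohomology_linearMap_of_injective [IsNoetherianRing R]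
    (M : Type u) [AddCommGroup M] [Module R M] [Module.Finite R M] (I : Ideal R) (E : Type u)
    [AddCommGroup E] [Module R E] [Module.Injective R E] (i : ℕ) :
    Limits.IsZero ((localCohomology I (i + 1)).obj (ModuleCat.of R (M →ₗ[R] E))) := by
  let D := localCohomology.diagram (localCohomology.idealPowersDiagram I) (i + 1)
  have hD : Limits.HasColimit D := localCohomology.hasColimitDiagram _ _
  let N := ModuleCat.of R (M →ₗ[R] E)
  change Limits.IsZero (((evaluation _ _).obj N).obj (Limits.colimit D))
  rw [Limits.IsZero.iff_id_eq_zero]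
  refine (Limits.isColimitOfPreserves ((evaluation _ _).obj N)
    (Limits.colimit.isColimit D)).hom_ext fun j => ?_
  obtain ⟨m, h, H⟩ := exists_extMapVanishes_quotientPowMap I i (unop (unop j)) M
  let P := projectiveResolution (ModuleCat.of R (R ⧸ I ^ m))
  let Q := projectiveResolution (ModuleCat.of R (R ⧸ I ^ unop (unop j)))
  let e : j ⟶ op (op m) := (homOfLE h).op.op
  have hz : (D.map e).app N = 0 :=
    Ext_map_app_eq_zero (ProjectiveResolution.lift_commutes (quotientPowMap I h) P Q)
      (H E P Q _ (ProjectiveResolution.lift_commutes (quotientPowMap I h) P Q))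
  have hj : (Limits.colimit.ι D j).app N = 0 := by
    rw [← Limits.colimit.w D e, NatTrans.comp_app, hz, Limits.zero_comp]
  change (Limits.colimit.ι D j).app N ≫ _ = (Limits.colimit.ι D j).app N ≫ _
  rw [hj, Limits.zero_comp, Limits.zero_comp]

end

theorem mainTheorem5 (R : Type u) [CommRing R] [IsNoetherianRing R]
    (M : Type u) [AddCommGroup M] [Module R M] [Module.Finite R M] :
    (∀ (I : Ideal R) (E : Type u) [AddCommGroup E] [Module R E], Module.Injective R E →
      ∀ i : ℕ, i ≠ 0 →
        Limits.IsZero ((localCohomology I i).obj (ModuleCat.of R (M →ₗ[R] E)))) ∧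
    (∀ xs : List R, IsWeaklyProregular xs M) := by
  refine ⟨fun I E _ _ hE i hi => ?_, fun xs => isWeaklyProregular_of_isNoetherian xs M⟩
  obtain ⟨i, rfl⟩ := Nat.exists_eq_succ_of_ne_zero hi
  exact isZero_localCohomology_linearMap_of_injective M I E i
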